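/- Let $R$ be a commutative ring. A cochain complex $A^\bullet$ of $R$-modules is *pure acyclic* if $N\otimes_R A^\bullet$ is acyclic for every $R$-module $N$; a morphism of complexes is a *pure quasi-isomorphism* if its mapping cone is pure acyclic. An $R$-module $P$ is *pure projective* if $\mathrm{Hom}_R(P,-)$ carries pure acyclic complexes to pure acyclic complexes. A complex $P^\bullet$ is *$K$-pure projective* if the internal Hom functor $\mathrm{Hom}_R^\bullet(P^\bullet,-)$ carries pure acyclic complexes to pure acyclic complexes. A *pure projective resolution* of $M^\bullet$ is a pure quasi-isomorphism $P^\bullet\to M^\bullet$ where $P^\bullet$ is a $K$-pure projective complex all of whose terms are pure projective modules. A direct system $P_0^\bullet\to P_1^\bullet\to\cdots$ of complexes is a *special direct system of $K$-pure projective complexes* if $P_0^\bullet$ is $K$-pure projective and, for every $n\ge 0$, the map $P_n^\bullet\to P_{n+1}^\bullet$ is injective, its cokernel $C_{n+1}^\bullet$ is $K$-pure projective, and $0\to P_n^\bullet\to P_{n+1}^\bullet\to C_{n+1}^\bullet\to 0$ is split in each degree. For $n\in\mathbb Z$ let $\tau_{\le n}M^\bullet\subseteq M^\bullet$ be the subcomplex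 equal to $M^i$ in degrees $i<n$, to $\ker(d^n)$ in degree $n$, and to $0$ in degrees $i>n$. **Theorem.** Let $M^\bullet$ be any cochain complex of $R$-modules, possibly unbounded. Then $M^\bullet$ has a pure projective resolution. More precisely, there are a special direct system $\{P_n^\bullet\}_{n\ge 0}$ of $K$-pure projective complexes and a morphism of direct systems $\{f_n:P_n^\bullet\to\tau_{\le n}M^\bullet\}_{n\ge 0}$ such that each $P_n^\bullet$ is bounded above and each $f_n$ is a pure projective resolution of $\tau_{\le n}M^\bullet$, and such that the morphism $$\varinjlim_{n\ge 0}P_n^\bullet\longrightarrow \varinjlim_{n\ge 0}\tau_{\le n}M^\bullet=M^\bullet$$ induced by the $f_n$ is a pure projective resolution of $M^\bullet$. -/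

import Mathlib

open CategoryTheory CategoryTheory.Limits Opposite

universe u

noncomputable section

namespace PureResolution

variable {R : Type u} [CommRing R]

/-- A complex `A` is pure acyclic if `N ⊗ A` is acyclic for every module `N`. -/
def IsPureAcyclic (A : CochainComplex (ModuleCat.{u} R) ℤ) : Prop :=
  ∀ N : ModuleCat.{u} R,
    (((MonoidalCategory.tensorLeft N).mapHomologicalComplex (ComplexShape.up ℤ)).obj A).Acyclic

/-- A morphism of complexes is a pure quasi-isomorphism if its mapping cone is pure acyclic. -/
def IsPureQuasiIso {K L : CochainComplex (ModuleCat.{u} R) ℤ} (f : K ⟶ L) : Prop :=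
  IsPureAcyclic (CochainComplex.mappingCone f)

/-- The complex `Hom_R(P, A)` of `R`-modules, for a module `P` and a complex `A`. -/
def moduleHomComplex (P : ModuleCat.{u} R) (A : CochainComplex (ModuleCat.{u} R) ℤ) :
    CochainComplex (ModuleCat.{u} R) ℤ :=
  (((linearCoyoneda R (ModuleCat.{u} R)).obj (op P)).mapHomologicalComplex
    (ComplexShape.up ℤ)).obj A

/-- A module `P` is pure projective if `Hom_R(P, -)` sends pure acyclic complexes to pure acyclic
complexes. -/
def IsPureProjective (P : ModuleCat.{u} R) : Prop :=
  ∀ A : CochainComplex (ModuleCat.{u} R) ℤ, IsPureAcyclic A →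
    IsPureAcyclic (moduleHomComplex P A)

/-- The internal Hom complex of `R`-modules: in degree `i` it is the product over `j` of the
modules `Hom_R (K^j, L^(i+j))`, with differential `f ↦ d ∘ f - (-1)^i f ∘ d`. It is Mathlib's
`CochainComplex.HomComplex` with its `R`-linear structure. -/
def homComplex (K L : CochainComplex (ModuleCat.{u} R) ℤ) :
    CochainComplex (ModuleCat.{u} R) ℤ where
  X i := ModuleCat.of R (CochainComplex.HomComplex.Cochain K L i)
  d i j := ModuleCat.ofHom (CochainComplex.HomComplex.δ_hom R K L i j)
  shape i j hij := by
    ext z : 2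
    exact CochainComplex.HomComplex.δ_shape i j hij z
  d_comp_d' i j k _ _ := by
    ext z : 2
    exact CochainComplex.HomComplex.δ_δ i j k z

/-- A complex `P` is K-pure projective if the internal Hom functor out of `P` sends pure acyclic
complexes to pure acyclic complexes. -/
def IsKPureProjective (P : CochainComplex (ModuleCat.{u} R) ℤ) : Prop :=
  ∀ A : CochainComplex (ModuleCat.{u} R) ℤ, IsPureAcyclic A → IsPureAcyclic (homComplex P A)

/-- `f : P ⟶ M` is a pure projective resolution of `M`. -/
structure IsPureProjectiveResolution {P M : CochainComplex (ModuleCat.{u} R) ℤ}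
    (f : P ⟶ M) : Prop where
  pureProjective : ∀ i : ℤ, IsPureProjective (P.X i)
  pureQuasiIso : IsPureQuasiIso f
  kPureProjective : IsKPureProjective P

/-- A complex is bounded above if its terms vanish in all sufficiently large degrees. -/
def IsBoundedAbove (K : CochainComplex (ModuleCat.{u} R) ℤ) : Prop :=
  ∃ n : ℤ, ∀ i : ℤ, n < i → IsZero (K.X i)

/-- The sequence `K ⟶ L ⟶ coker f` attached to a morphism of complexes `f`. -/
def cokernelSequence {K L : CochainComplex (ModuleCat.{u} R) ℤ} (f : K ⟶ L) :
    ShortComplex (CochainComplex (ModuleCat.{u} R) ℤ) :=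
  ShortComplex.mk f (cokernel.π f) (cokernel.condition f)

/-- A direct system `P₀ ⟶ P₁ ⟶ ⋯` of complexes is `T`-special if all transition morphisms are
injective, their cokernels belong to `T`, and the sequences `0 ⟶ Pₙ ⟶ Pₙ₊₁ ⟶ Cₙ₊₁ ⟶ 0` split in
each degree. The system is understood to be extended by `0` to negative indices, so that the
first cokernel is `P₀` itself. -/
structure IsSpecialDirectSystem (T : CochainComplex (ModuleCat.{u} R) ℤ → Prop)
    (P : ℕ ⥤ CochainComplex (ModuleCat.{u} R) ℤ) : Prop where
  zero_mem : T (P.obj 0)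
  mono : ∀ n : ℕ, Mono (P.map (homOfLE n.le_succ))
  cokernel_mem : ∀ n : ℕ, T (cokernel (P.map (homOfLE n.le_succ)))
  semisplit : ∀ (n : ℕ) (i : ℤ), Nonempty
    ((cokernelSequence (P.map (homOfLE n.le_succ))).map
      (HomologicalComplex.eval (ModuleCat.{u} R) (ComplexShape.up ℤ) i)).Splitting

/-- The canonical morphism `τ_{≤ m} M ⟶ τ_{≤ n} M` for `m ≤ n`; it is the unique morphism
compatible with the inclusions into `M`. -/
def truncLETransition (M : CochainComplex (ModuleCat.{u} R) ℤ) (m n : ℤ) (h : m ≤ n) :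
    M.truncLE m ⟶ M.truncLE n :=
  haveI : (M.truncLE m).IsStrictlyLE n := (M.truncLE m).isStrictlyLE_of_le m n h
  inv ((M.truncLE m).ιTruncLE n) ≫ CochainComplex.truncLEMap (M.ιTruncLE m) n

lemma truncLETransition_ι (M : CochainComplex (ModuleCat.{u} R) ℤ) (m n : ℤ) (h : m ≤ n) :
    truncLETransition M m n h ≫ M.ιTruncLE n = M.ιTruncLE m := by
  have : (M.truncLE m).IsStrictlyLE n := (M.truncLE m).isStrictlyLE_of_le m n h
  simp [truncLETransition]

lemma mono_ιTruncLE (M : CochainComplex (ModuleCat.{u} R) ℤ) (n : ℤ) : Mono (M.ιTruncLE n) := by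
  dsimp [CochainComplex.ιTruncLE]
  infer_instance

/-- The direct system of truncations `τ_{≤ 0} M ⟶ τ_{≤ 1} M ⟶ ⋯`. -/
def truncLESystem (M : CochainComplex (ModuleCat.{u} R) ℤ) :
    ℕ ⥤ CochainComplex (ModuleCat.{u} R) ℤ where
  obj n := M.truncLE (n : ℤ)
  map {m n} f := truncLETransition M m n (by exact_mod_cast leOfHom f)
  map_id n := by
    have := mono_ιTruncLE M n
    rw [← cancel_mono (M.ιTruncLE n), truncLETransition_ι, Category.id_comp]
  map_comp {m n k} f g := by
    have := mono_ιTruncLE M k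
    rw [← cancel_mono (M.ιTruncLE k), Category.assoc, truncLETransition_ι, truncLETransition_ι,
      truncLETransition_ι]

/-- The cocone on the system of truncations given by the inclusions `τ_{≤ n} M ⟶ M`. -/
def truncLECocone (M : CochainComplex (ModuleCat.{u} R) ℤ) : Cocone (truncLESystem M) where
  pt := M
  ι :=
    { app := fun n => M.ιTruncLE (n : ℤ)
      naturality := fun m n f => by
        simpa [truncLESystem] using
          truncLETransition_ι M m n (by exact_mod_cast leOfHom f) }

end PureResolution

end

/-!
A complex `A` is pure acyclic if and only if `Hom(F, A)` is acyclic for every finitely presented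
module `F`: by the equational criterion for the vanishing of tensors, both conditions say that `A`
is exact and that its modules of cocycles are pure submodules. Pure projective resolutions are thus
resolutions relative to a small family of test modules, and the small object argument provides them.

Given `g : P ⟶ N`, attach to `P` one cell for every cocycle of the cone of `g` defined on a test
module. The new complex `P'` contains `P` as a degreewise split subcomplex, the quotient is a sum of
shifted test modules, and every such cocycle becomes a coboundary in the cone of `P' ⟶ N`. After
countably many such steps the cone of the colimit is pure acyclic, because maps from finitely
presented modules factor through a stage. No cells are attached in degrees where `P` and `N`
vanish, so bounds are preserved. Resolving `P n ⟶ τ_{≤ n} M ⟶ τ_{≤ n + 1} M` in this way for each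
`n` produces the special direct system.

A solution of `δ y = z` on `P n` extends to a solution on `P (n + 1)`, because the inclusion is
degreewise split. So acyclicity of `Hom(P n, A)` for pure acyclic `A` passes to the colimit, and
pure acyclicity of the cones does by smallness. Finally, acyclicity of `Hom(P, A)` for all pure
acyclic `A` already implies its pure acyclicity, since
`Hom(F, Hom(P, A)) ≃ Hom(P, Hom(F, A))` and `Hom(F, A)` is again pure acyclic if `F` is finitely
presented: a tensor product of finitely presented modules is finitely presented.
-/

universe v w

noncomputable section

namespace PureResolution

section Sequences

lemma exists_seq {T : ℕ → Type*} (S : ∀ n, T n → Prop) (r : ∀ n, T n → T (n + 1) → Prop)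
    (zero : ∃ y, S 0 y) (succ : ∀ n y, S n y → ∃ y', S (n + 1) y' ∧ r n y y') :
    ∃ y : ∀ n, T n, ∀ n, S n (y n) ∧ r n (y n) (y (n + 1)) := by
  choose g hg using succ
  let y : ∀ n, { y : T n // S n y } := fun n =>
    Nat.rec ⟨zero.choose, zero.choose_spec⟩ (fun n y => ⟨g n y.1 y.2, (hg n y.1 y.2).1⟩) n
  exact ⟨fun n => (y n).1, fun n => ⟨(y n).2, (hg n _ (y n).2).2⟩⟩

variable {C : Type*} [Category* C] {X : ℕ ⥤ C}

/-- The cocone on a sequence given by a family of morphisms compatible with its transition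
morphisms. -/
def coconeOfSequence {Y : C} (y : ∀ n, X.obj n ⟶ Y)
    (hy : ∀ n, X.map (homOfLE n.le_succ) ≫ y (n + 1) = y n) : Cocone X where
  pt := Y
  ι := NatTrans.ofSequence y fun n => (hy n).trans (Category.comp_id _).symm

variable {c : Cocone X}

lemma exists_desc_of_sequence (hc : IsColimit c) {Y : C} (y : ∀ n, X.obj n ⟶ Y)
    (hy : ∀ n, X.map (homOfLE n.le_succ) ≫ y (n + 1) = y n) :
    ∃ t : c.pt ⟶ Y, ∀ n, c.ι.app n ≫ t = y n :=
  ⟨hc.desc (coconeOfSequence y hy), hc.fac _⟩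

lemma isSplitMono_ι_zero (hc : IsColimit c)
    (hX : ∀ n : ℕ, IsSplitMono (X.map (homOfLE n.le_succ))) : IsSplitMono (c.ι.app 0) := by
  obtain ⟨y, hy⟩ := exists_seq (T := fun n => X.obj n ⟶ X.obj 0)
    (fun n y => X.map (homOfLE n.zero_le) ≫ y = 𝟙 _)
    (fun n y y' => X.map (homOfLE n.le_succ) ≫ y' = y)
    ⟨𝟙 _, by simp⟩ (by
      intro n y hy
      have := hX n
      have h : X.map (homOfLE n.le_succ) ≫ retraction (X.map (homOfLE n.le_succ)) ≫ y = y := by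
        simp
      refine ⟨_, ?_, h⟩
      rw [← homOfLE_comp n.zero_le n.le_succ, X.map_comp, Category.assoc, h, hy])
  obtain ⟨t, ht⟩ := exists_desc_of_sequence hc y fun n => (hy n).2
  exact IsSplitMono.mk' ⟨t, by simpa [ht] using (hy 0).1⟩

lemma isZero_of_isColimit {C J : Type*} [Category* C] [Category* J] [HasZeroMorphisms C] {X : J ⥤ C}
    {c : Cocone X} (hc : IsColimit c) (hX : ∀ n, IsZero (X.obj n)) : IsZero c.pt :=
  (IsZero.iff_id_eq_zero _).2 (hc.hom_ext fun n => (hX n).eq_of_src _ _)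

end Sequences

section HomAcyclic

variable {C : Type*} [Category* C] [Preadditive C] {A : CochainComplex C ℤ}

/-- The complex of abelian groups `Hom(X, A)` is acyclic: every cocycle `x : X ⟶ A.X j` is a
coboundary. -/
def IsHomAcyclic (X : C) (A : CochainComplex C ℤ) : Prop :=
  ∀ i j k : ℤ, i + 1 = j → j + 1 = k → ∀ x : X ⟶ A.X j, x ≫ A.d j k = 0 →
    ∃ y : X ⟶ A.X i, y ≫ A.d i j = x

namespace IsHomAcyclic

lemma of_isZero {X : C} (hX : IsZero X) : IsHomAcyclic X A :=
  fun _ _ _ _ _ _ _ => ⟨0, hX.eq_of_src _ _⟩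

lemma of_iso {X Y : C} (e : X ≅ Y) (hX : IsHomAcyclic X A) : IsHomAcyclic Y A := by
  intro i j k hij hjk x hx
  obtain ⟨y, hy⟩ := hX i j k hij hjk (e.hom ≫ x) (by simp [hx])
  exact ⟨e.inv ≫ y, by simp [hy]⟩

lemma sigma {ι : Type*} {X : ι → C} [HasCoproduct X] (hX : ∀ a, IsHomAcyclic (X a) A) :
    IsHomAcyclic (∐ X) A := by
  intro i j k hij hjk x hx
  choose y hy using fun a => hX a i j k hij hjk (Sigma.ι X a ≫ x) (by simp [hx])
  exact ⟨Sigma.desc y, Sigma.hom_ext _ _ fun a => by simp [hy]⟩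

lemma exists_extension {X Y : C} (f : X ⟶ Y) [IsSplitMono f] (hY : IsHomAcyclic Y A) {i j k : ℤ}
    (hij : i + 1 = j) (hjk : j + 1 = k) {z : Y ⟶ A.X j} (hz : z ≫ A.d j k = 0) {w : X ⟶ A.X i}
    (hw : w ≫ A.d i j = f ≫ z) : ∃ w' : Y ⟶ A.X i, w' ≫ A.d i j = z ∧ f ≫ w' = w := by
  obtain ⟨y, hy⟩ := hY i j k hij hjk z hz
  refine ⟨y + retraction f ≫ (w - f ≫ y), ?_, by simp⟩
  simp [hy, hw]

lemma of_isColimit {X : ℕ ⥤ C} {c : Cocone X} (hc : IsColimit c)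
    (hX : ∀ n, IsHomAcyclic (X.obj n) A)
    (hs : ∀ n : ℕ, IsSplitMono (X.map (homOfLE n.le_succ))) : IsHomAcyclic c.pt A := by
  intro i j k hij hjk x hx
  have hxn : ∀ n, (c.ι.app n ≫ x) ≫ A.d j k = 0 := by simp [hx]
  obtain ⟨y, hy⟩ := exists_seq (T := fun n => X.obj n ⟶ A.X i)
    (fun n y => y ≫ A.d i j = c.ι.app n ≫ x)
    (fun n y y' => X.map (homOfLE n.le_succ) ≫ y' = y)
    (hX 0 i j k hij hjk _ (hxn 0)) fun n y hy =>
      have := hs n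
      exists_extension _ (hX (n + 1)) hij hjk (hxn (n + 1)) (by simp [hy])
  obtain ⟨t, ht⟩ := exists_desc_of_sequence hc y fun n => (hy n).2
  exact ⟨t, hc.hom_ext fun n => by rw [reassoc_of% ht, (hy n).1]⟩

lemma mappingCone_X [HasBinaryBiproducts C] {K L : CochainComplex C ℤ} (φ : K ⟶ L) {p q : ℤ}
    (hpq : p + 1 = q) (hK : IsHomAcyclic (K.X q) A) (hL : IsHomAcyclic (L.X p) A) :
    IsHomAcyclic ((CochainComplex.mappingCone φ).X p) A := by
  intro i j k hij hjk x hx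
  obtain ⟨y, hy⟩ := hK i j k hij hjk
    ((CochainComplex.mappingCone.inl φ).v q p (by lia) ≫ x) (by simp [hx])
  obtain ⟨z, hz⟩ := hL i j k hij hjk
    ((CochainComplex.mappingCone.inr φ).f p ≫ x) (by simp [hx])
  refine ⟨(CochainComplex.mappingCone.fst φ).1.v p q hpq ≫ y +
    (CochainComplex.mappingCone.snd φ).v p p (add_zero p) ≫ z, ?_⟩
  simp [CochainComplex.mappingCone.ext_from_iff φ q p hpq, hy, hz]

end IsHomAcyclic

end HomAcyclic

open CochainComplex CochainComplex.HomComplex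

section CochainAcyclic

variable {C : Type*} [Category* C] [Preadditive C] {A : CochainComplex C ℤ}

/-- The complex of abelian groups `Hom(P, A)` of Mathlib's `CochainComplex.HomComplex` is acyclic:
every cocycle of degree `j` is a coboundary. -/
def IsCochainAcyclic (P A : CochainComplex C ℤ) : Prop :=
  ∀ i j k : ℤ, i + 1 = j → j + 1 = k → ∀ z : Cochain P A j, δ j k z = 0 →
    ∃ y : Cochain P A i, δ i j y = z

namespace IsCochainAcyclic

lemma of_d_eq_zero {Q : CochainComplex C ℤ} (hd : ∀ i j, Q.d i j = 0)
    (hQ : ∀ i, IsHomAcyclic (Q.X i) A) : IsCochainAcyclic Q A := by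
  intro i j k hij hjk z hz
  have h : ∀ p q (hpq : p + i = q), ∃ y : Q.X p ⟶ A.X q,
      y ≫ A.d q (q + 1) = z.v p (q + 1) (by lia) := by
    intro p q hpq
    refine hQ p q (q + 1) (q + 1 + 1) rfl rfl _ ?_
    have := Cochain.congr_v hz p (q + 1 + 1) (by lia)
    rwa [δ_v j k hjk _ p (q + 1 + 1) (by lia) (q + 1) (p + 1) (by lia) rfl, hd, zero_comp,
      smul_zero, add_zero] at this
  choose y hy using h
  refine ⟨Cochain.mk y, ?_⟩
  ext1 p q hpq
  obtain rfl : q = (p + i) + 1 := by lia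
  rw [δ_v i j hij _ p (p + i + 1) (by lia) (p + i) (p + 1) (by lia) rfl, hd, zero_comp, smul_zero,
    add_zero, Cochain.mk_v, hy]

variable {K L : CochainComplex C ℤ}

lemma exists_extension (f : K ⟶ L) [∀ p, IsSplitMono (f.f p)] (hK : IsCochainAcyclic K A)
    (hL : IsCochainAcyclic L A) {i j k : ℤ} (hij : i + 1 = j) (hjk : j + 1 = k)
    {z : Cochain L A j} (hz : δ j k z = 0) {w : Cochain K A i}
    (hw : δ i j w = (Cochain.ofHom f).comp z (zero_add j)) :
    ∃ w' : Cochain L A i, δ i j w' = z ∧ (Cochain.ofHom f).comp w' (zero_add i) = w := by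
  -- A solution `y` on `L` differs from `w` on `K` by a coboundary, which extends to `L`.
  obtain ⟨y, hy⟩ := hL i j k hij hjk z hz
  obtain ⟨t, ht⟩ := hK (i - 1) i j (by lia) hij (w - (Cochain.ofHom f).comp y (zero_add i)) (by
    rw [δ_sub, δ_ofHom_comp, hw, hy, sub_self])
  let r : Cochain L K 0 := Cochain.ofHoms fun p => retraction (f.f p)
  have hr : (Cochain.ofHom f).comp r (add_zero 0) = Cochain.ofHom (𝟙 K) := by
    ext p
    simp [r]
  refine ⟨y + δ (i - 1) i (r.comp t (zero_add _)), by rw [δ_add, δ_δ, hy, add_zero], ?_⟩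
  rw [Cochain.comp_add, ← δ_ofHom_comp, ← Cochain.comp_assoc_of_first_is_zero_cochain, hr,
    Cochain.id_comp, ht, add_sub_cancel]

lemma of_degreewise_splitting (S : ShortComplex (CochainComplex C ℤ))
    (σ : ∀ p, (S.map (HomologicalComplex.eval C _ p)).Splitting)
    (h₁ : IsCochainAcyclic S.X₁ A) (h₂ : IsCochainAcyclic S.X₂ A) :
    IsCochainAcyclic S.X₃ A := by
  intro i j k hij hjk z hz
  have (p : ℤ) : IsSplitMono (S.f.f p) := (σ p).isSplitMono_f
  let r (p : ℤ) : S.X₂.X p ⟶ S.X₁.X p := (σ p).r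
  let s (p : ℤ) : S.X₃.X p ⟶ S.X₂.X p := (σ p).s
  have hs (p : ℤ) : s p ≫ S.g.f p = 𝟙 _ := (σ p).s_g
  have hrs (p : ℤ) : r p ≫ S.f.f p + S.g.f p ≫ s p = 𝟙 _ := (σ p).id
  have hsg : (Cochain.ofHoms s).comp (Cochain.ofHom S.g) (add_zero 0) = Cochain.ofHom (𝟙 S.X₃) := by
    ext p
    simp [hs]
  obtain ⟨w, hw, hfw⟩ := exists_extension (A := A) S.f h₁ h₂ hij hjk
    (z := (Cochain.ofHom S.g).comp z (zero_add j)) (w := 0)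
    (by rw [δ_ofHom_comp, hz, Cochain.comp_zero]) (by
      rw [δ_zero, ← Cochain.comp_assoc_of_first_is_zero_cochain, ← Cochain.ofHom_comp, S.zero,
        Cochain.ofHom_zero, Cochain.zero_comp])
  have hgs : (Cochain.ofHom S.g).comp
      ((Cochain.ofHoms s).comp w (zero_add i)) (zero_add i) = w := by
    ext1 p q hpq
    have hw₀ : S.f.f p ≫ w.v p q hpq = 0 := by simpa using Cochain.congr_v hfw p q hpq
    rw [← Category.id_comp (w.v p q hpq), ← hrs]
    simp [hw₀]
  refine ⟨(Cochain.ofHoms s).comp w (zero_add i), ?_⟩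
  rw [← Cochain.id_comp (δ i j _), ← hsg, Cochain.comp_assoc_of_first_is_zero_cochain,
    ← δ_ofHom_comp, hgs, hw, ← Cochain.comp_assoc_of_first_is_zero_cochain, hsg, Cochain.id_comp]

lemma mappingCone [HasBinaryBiproducts C] (φ : K ⟶ L) (hK : IsCochainAcyclic K A)
    (hL : IsCochainAcyclic L A) : IsCochainAcyclic (mappingCone φ) A := by
  intro i j k hij hjk z hz
  obtain ⟨β, hβ⟩ := hL i j k hij hjk ((Cochain.ofHom (mappingCone.inr φ)).comp z (zero_add j))
    (by rw [δ_ofHom_comp, hz, Cochain.comp_zero])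
  let α : Cochain K A i := (mappingCone.inl φ).comp z (by lia)
  let φβ : Cochain K A i := (Cochain.ofHom φ).comp β (zero_add i)
  have hα : δ i j α + k.negOnePow • δ i j φβ = 0 := by
    have hz' : z = mappingCone.descCochain φ α
        ((Cochain.ofHom (mappingCone.inr φ)).comp z (zero_add j)) hij := by
      simp [mappingCone.ext_cochain_from_iff φ i j hij, α]
    have h := congrArg (fun t => (mappingCone.inl φ).comp t (by lia : -1 + k = j))
      ((mappingCone.δ_descCochain φ α _ hij k hjk).symm.trans (hz' ▸ hz))
    simpa [φβ, hβ] using h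
  obtain ⟨γ, hγ⟩ := hK (i - 1) i j (by lia) hij (α + k.negOnePow • φβ) (by
    rw [δ_add, δ_units_smul, hα])
  refine ⟨mappingCone.descCochain φ γ β (by lia), ?_⟩
  rw [mappingCone.ext_cochain_from_iff φ i j hij, mappingCone.δ_descCochain φ γ β _ j hij]
  constructor
  · simp [hγ, α, φβ, ← hjk, Int.negOnePow_succ]
  · simp [hβ]

lemma exists_cochain_desc {P : ℕ ⥤ CochainComplex C ℤ} {c : Cocone P}
    (hc : ∀ p, IsColimit ((HomologicalComplex.eval C _ p).mapCocone c)) {i : ℤ}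
    (w : ∀ n, Cochain (P.obj n) A i)
    (hw : ∀ n, (Cochain.ofHom (P.map (homOfLE n.le_succ))).comp (w (n + 1)) (zero_add i) = w n) :
    ∃ w' : Cochain c.pt A i, ∀ n, (Cochain.ofHom (c.ι.app n)).comp w' (zero_add i) = w n := by
  have h (p q : ℤ) (hpq : p + i = q) :
      ∃ t : c.pt.X p ⟶ A.X q, ∀ n, (c.ι.app n).f p ≫ t = (w n).v p q hpq :=
    exists_desc_of_sequence (hc p) (fun n => (w n).v p q hpq) fun n => by
      have := Cochain.congr_v (hw n) p q hpq
      rwa [Cochain.zero_cochain_comp_v, Cochain.ofHom_v] at this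
  choose t ht using h
  refine ⟨Cochain.mk t, fun n => ?_⟩
  ext p q hpq
  simp [ht]

lemma of_isColimit {P : ℕ ⥤ CochainComplex C ℤ} {c : Cocone P}
    (hc : ∀ p, IsColimit ((HomologicalComplex.eval C _ p).mapCocone c))
    (hP : ∀ n, IsCochainAcyclic (P.obj n) A)
    (hs : ∀ (n : ℕ) (p : ℤ), IsSplitMono ((P.map (homOfLE n.le_succ)).f p)) :
    IsCochainAcyclic c.pt A := by
  intro i j k hij hjk z hz
  let zn (n : ℕ) : Cochain (P.obj n) A j := (Cochain.ofHom (c.ι.app n)).comp z (zero_add j)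
  have hzn (n : ℕ) : δ j k (zn n) = 0 := by rw [δ_ofHom_comp, hz, Cochain.comp_zero]
  obtain ⟨w, hw⟩ := exists_seq (T := fun n => Cochain (P.obj n) A i)
    (fun n w => δ i j w = zn n)
    (fun n w w' => (Cochain.ofHom (P.map (homOfLE n.le_succ))).comp w' (zero_add i) = w)
    (hP 0 i j k hij hjk _ (hzn 0)) fun n w hw =>
      have := hs n
      exists_extension _ (hP n) (hP (n + 1)) hij hjk (hzn (n + 1)) (by
        rw [hw, ← Cochain.comp_assoc_of_first_is_zero_cochain, ← Cochain.ofHom_comp, c.w])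
  obtain ⟨w', hw'⟩ := exists_cochain_desc hc w fun n => (hw n).2
  refine ⟨w', ?_⟩
  ext1 p q hpq
  refine (hc p).hom_ext fun n => ?_
  have h : (Cochain.ofHom (c.ι.app n)).comp (δ i j w') (zero_add j) = zn n := by
    rw [← δ_ofHom_comp, hw', (hw n).1]
  have := Cochain.congr_v h p q hpq
  rwa [Cochain.zero_cochain_comp_v, Cochain.zero_cochain_comp_v, Cochain.ofHom_v] at this

end IsCochainAcyclic

end CochainAcyclic

section HomColimit

variable {C : Type*} [Category* C] [Preadditive C] {J : Type*} [Category* J]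

/-- In each degree, the functor `Hom(F, -)` identifies `L` with the colimit of the filtered diagram
`X` of complexes along the morphisms `ι n : X.obj n ⟶ L`: every morphism `F ⟶ L.X p` comes from some
stage of the diagram, and a morphism to some stage which vanishes in `L` vanishes at a later
stage. -/
structure IsHomColimit (F : C) (X : J ⥤ CochainComplex C ℤ) {L : CochainComplex C ℤ}
    (ι : ∀ n, X.obj n ⟶ L) : Prop where
  map_comp_ι : ∀ {n m : J} (f : n ⟶ m), X.map f ≫ ι m = ι n
  exists_lift : ∀ (p : ℤ) (x : F ⟶ L.X p),
    ∃ (n : J) (y : F ⟶ (X.obj n).X p), y ≫ (ι n).f p = x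
  exists_eq_zero : ∀ (p : ℤ) (n : J) (x : F ⟶ (X.obj n).X p), x ≫ (ι n).f p = 0 →
    ∃ (m : J) (f : n ⟶ m), x ≫ (X.map f).f p = 0

namespace IsHomColimit

variable {F : C}

lemma const [Nonempty J] (N : CochainComplex C ℤ) :
    IsHomColimit F ((Functor.const J).obj N) fun _ => 𝟙 N where
  map_comp_ι _ := Category.comp_id _
  exists_lift _ x := ⟨Classical.arbitrary J, x, Category.comp_id _⟩
  exists_eq_zero _ n _ hx := ⟨n, 𝟙 n, hx⟩

variable {X : J ⥤ CochainComplex C ℤ} {L : CochainComplex C ℤ} {ι : ∀ n, X.obj n ⟶ L}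

lemma map_f_comp_ι_f (hι : IsHomColimit F X ι) {n m : J} (f : n ⟶ m) (p : ℤ) :
    (X.map f).f p ≫ (ι m).f p = (ι n).f p := by
  rw [← HomologicalComplex.comp_f, hι.map_comp_ι]

lemma isHomAcyclic (hι : IsHomColimit F X ι)
    (h : ∀ (n : J) (i j k : ℤ), i + 1 = j → j + 1 = k → ∀ x : F ⟶ (X.obj n).X j,
      x ≫ (X.obj n).d j k = 0 →
      ∃ (m : J) (f : n ⟶ m) (y : F ⟶ (X.obj m).X i), y ≫ (X.obj m).d i j = x ≫ (X.map f).f j) :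
    IsHomAcyclic F L := by
  intro i j k hij hjk x hx
  obtain ⟨n, x, rfl⟩ := hι.exists_lift j x
  obtain ⟨m, f, hm⟩ := hι.exists_eq_zero k n (x ≫ (X.obj n).d j k) (by simpa using hx)
  obtain ⟨l, g, y, hy⟩ := h m i j k hij hjk (x ≫ (X.map f).f j) (by simpa using hm)
  refine ⟨y ≫ (ι l).f i, ?_⟩
  rw [Category.assoc, (ι l).comm, reassoc_of% hy, hι.map_f_comp_ι_f, hι.map_f_comp_ι_f]

lemma isHomAcyclic_of_obj (hι : IsHomColimit F X ι) (hX : ∀ n, IsHomAcyclic F (X.obj n)) :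
    IsHomAcyclic F L :=
  hι.isHomAcyclic fun n i j k hij hjk x hx =>
    have ⟨y, hy⟩ := hX n i j k hij hjk x hx
    ⟨n, 𝟙 n, y, by simp [hy]⟩

end IsHomColimit

section MappingCone

variable [HasBinaryBiproducts C]

lemma decomp_comp_map_f {K₁ L₁ K₂ L₂ : CochainComplex C ℤ} (φ₁ : K₁ ⟶ L₁) (φ₂ : K₂ ⟶ L₂)
    (a : K₁ ⟶ K₂) (b : L₁ ⟶ L₂) (comm : φ₁ ≫ b = a ≫ φ₂) {F : C} {p q : ℤ} (hpq : p + (-1) = q)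
    (x : F ⟶ K₁.X p) (y : F ⟶ L₁.X q) :
    (x ≫ (mappingCone.inl φ₁).v p q hpq + y ≫ (mappingCone.inr φ₁).f q) ≫
        (mappingCone.map φ₁ φ₂ a b comm).f q =
      (x ≫ a.f p) ≫ (mappingCone.inl φ₂).v p q hpq +
        (y ≫ b.f q) ≫ (mappingCone.inr φ₂).f q := by
  simp [mappingCone.map]

lemma decomp_eq_zero_iff {K L : CochainComplex C ℤ} (φ : K ⟶ L) {F : C} {p q : ℤ}
    (hpq : p + (-1) = q) (x : F ⟶ K.X p) (y : F ⟶ L.X q) :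
    x ≫ (mappingCone.inl φ).v p q hpq + y ≫ (mappingCone.inr φ).f q = 0 ↔ x = 0 ∧ y = 0 := by
  simp [mappingCone.ext_to_iff φ q p (by lia)]

variable {X Y : J ⥤ CochainComplex C ℤ} (φ : X ⟶ Y)

/-- The diagram of mapping cones of the components of a natural transformation. -/
@[simps]
def mappingConeDiagram : J ⥤ CochainComplex C ℤ where
  obj n := mappingCone (φ.app n)
  map f := mappingCone.map _ _ (X.map f) (Y.map f) (φ.naturality f).symm
  map_id n := by simp [mappingCone.map_id]
  map_comp f g := by simp [← mappingCone.map_comp]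

variable {F : C} {K L : CochainComplex C ℤ} {ι : ∀ n, X.obj n ⟶ K} {κ : ∀ n, Y.obj n ⟶ L}

lemma IsHomColimit.mappingCone [IsFiltered J] (hι : IsHomColimit F X ι) (hκ : IsHomColimit F Y κ)
    (g : K ⟶ L) (hg : ∀ n, φ.app n ≫ κ n = ι n ≫ g) :
    IsHomColimit F (mappingConeDiagram φ) fun n => mappingCone.map _ g (ι n) (κ n) (hg n) where
  map_comp_ι f := by
    refine (mappingCone.map_comp _ _ _ _ _ (φ.naturality f).symm _ _ (hg _)).symm.trans ?_
    simp only [hι.map_comp_ι, hκ.map_comp_ι]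
  exists_lift p x := by
    obtain ⟨x₁, x₂, rfl⟩ := mappingCone.decomp_to g x (p + 1) rfl
    obtain ⟨n₁, y₁, rfl⟩ := hι.exists_lift _ x₁
    obtain ⟨n₂, y₂, rfl⟩ := hκ.exists_lift _ x₂
    let a := IsFiltered.leftToMax n₁ n₂
    let b := IsFiltered.rightToMax n₁ n₂
    refine ⟨_, _, (decomp_comp_map_f _ g _ _ (hg _) (by lia)
      (y₁ ≫ (X.map a).f (p + 1)) (y₂ ≫ (Y.map b).f p)).trans ?_⟩
    rw [Category.assoc y₁, Category.assoc y₂, hι.map_f_comp_ι_f, hκ.map_f_comp_ι_f]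
  exists_eq_zero p n x hx := by
    obtain ⟨x₁, x₂, rfl⟩ := mappingCone.decomp_to (φ.app n) x (p + 1) rfl
    obtain ⟨h₁, h₂⟩ := (decomp_eq_zero_iff g (by lia) _ _).1
      ((decomp_comp_map_f _ g _ _ (hg n) _ x₁ x₂).symm.trans hx)
    obtain ⟨m, f, hf⟩ := hι.exists_eq_zero _ n x₁ h₁
    obtain ⟨l, f', hf'⟩ := hκ.exists_eq_zero _ m (x₂ ≫ (Y.map f).f p) (by
      rw [Category.assoc, hκ.map_f_comp_ι_f, h₂])
    refine ⟨l, f ≫ f', (decomp_comp_map_f _ _ _ _ (φ.naturality _).symm _ x₁ x₂).trans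
      ((decomp_eq_zero_iff (φ.app l) _ _ _).2 ⟨?_, ?_⟩)⟩
    · rw [X.map_comp, HomologicalComplex.comp_f, reassoc_of% hf, zero_comp]
    · rwa [Y.map_comp, HomologicalComplex.comp_f, ← Category.assoc]

end MappingCone

end HomColimit

section Relative

variable {C : Type w} [Category.{v} C] [Preadditive C] {ι : Type v} (G : ι → C)

/-- A complex `A` is acyclic relative to the family of test objects `G` if all the complexes
`Hom(G a, A)` are acyclic. -/
def IsRelAcyclic (A : CochainComplex C ℤ) : Prop :=
  ∀ a, IsHomAcyclic (G a) A

/-- `P` is semi-projective relative to the test objects `G`: the functors `Hom(P.X p, -)` and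
`Hom(P, -)` send `G`-acyclic complexes to acyclic complexes. -/
structure IsRelSemiprojective (P : CochainComplex C ℤ) : Prop where
  isHomAcyclic_X : ∀ {A : CochainComplex C ℤ}, IsRelAcyclic G A → ∀ p, IsHomAcyclic (P.X p) A
  isCochainAcyclic : ∀ {A : CochainComplex C ℤ}, IsRelAcyclic G A → IsCochainAcyclic P A

/-- A sequentially small object in the sense of the small object argument: mapping out of `F`
commutes with colimits of sequences of complexes. -/
def IsSequentiallySmall (F : C) : Prop :=
  ∀ (X : ℕ ⥤ CochainComplex C ℤ) (c : Cocone X), IsColimit c → IsHomColimit F X c.ι.app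

variable {G}

namespace IsRelSemiprojective

lemma of_d_eq_zero {Q : CochainComplex C ℤ} (hd : ∀ i j, Q.d i j = 0)
    (hQ : ∀ {A : CochainComplex C ℤ}, IsRelAcyclic G A → ∀ p, IsHomAcyclic (Q.X p) A) :
    IsRelSemiprojective G Q where
  isHomAcyclic_X := hQ
  isCochainAcyclic hA := .of_d_eq_zero hd (hQ hA)

lemma of_isZero {Q : CochainComplex C ℤ} (hQ : IsZero Q) : IsRelSemiprojective G Q :=
  .of_d_eq_zero (fun i _ => ((HomologicalComplex.eval C _ i).map_isZero hQ).eq_of_src _ _)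
    fun _ p => .of_isZero ((HomologicalComplex.eval C _ p).map_isZero hQ)

variable {K L : CochainComplex C ℤ}

lemma mappingCone [HasBinaryBiproducts C] (hK : IsRelSemiprojective G K)
    (hL : IsRelSemiprojective G L) (φ : K ⟶ L) :
    IsRelSemiprojective G (CochainComplex.mappingCone φ) where
  isHomAcyclic_X hA p := .mappingCone_X φ rfl (hK.isHomAcyclic_X hA _) (hL.isHomAcyclic_X hA p)
  isCochainAcyclic hA := .mappingCone φ (hK.isCochainAcyclic hA) (hL.isCochainAcyclic hA)

lemma of_isColimit [HasColimitsOfShape ℕ C] {P : ℕ ⥤ CochainComplex C ℤ} {c : Cocone P}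
    (hc : IsColimit c) (hP : ∀ n, IsRelSemiprojective G (P.obj n))
    (hs : ∀ (n : ℕ) (p : ℤ), IsSplitMono ((P.map (homOfLE n.le_succ)).f p)) :
    IsRelSemiprojective G c.pt where
  isHomAcyclic_X hA p := .of_isColimit
    (isColimitOfPreserves (HomologicalComplex.eval C (ComplexShape.up ℤ) p) hc)
    (fun n => (hP n).isHomAcyclic_X hA p) fun n => hs n p
  isCochainAcyclic hA := .of_isColimit
    (fun p => isColimitOfPreserves (HomologicalComplex.eval C (ComplexShape.up ℤ) p) hc)
    (fun n => (hP n).isCochainAcyclic hA) hs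

end IsRelSemiprojective

section Cells

variable [HasBinaryBiproducts C] {P N : CochainComplex C ℤ} (G) (g : P ⟶ N)

/-- A degree `p` cell to be attached to `P` over `N`: a nonzero cocycle of the mapping cone of `g`
defined on one of the test objects. Zero is excluded so that no cells are attached in the degrees
where the mapping cone vanishes. -/
structure Cell (p : ℤ) : Type v where
  index : ι
  hom : G index ⟶ (mappingCone g).X (p - 1)
  hom_d : hom ≫ (mappingCone g).d (p - 1) p = 0
  hom_ne_zero : hom ≠ 0

variable {G g}

namespace Cell

variable {p : ℤ} (c : Cell G g p)

/-- The component in `P` of the cocycle defining a cell. -/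
def fst : G c.index ⟶ P.X p := c.hom ≫ (mappingCone.fst g).1.v (p - 1) p (by lia)

/-- The component in `N` of the cocycle defining a cell. -/
def snd : G c.index ⟶ N.X (p - 1) := c.hom ≫ (mappingCone.snd g).v (p - 1) (p - 1) (add_zero _)

lemma hom_eq : c.hom = c.fst ≫ (mappingCone.inl g).v p (p - 1) (by lia) +
    c.snd ≫ (mappingCone.inr g).f (p - 1) := by
  simp [mappingCone.ext_to_iff g (p - 1) p (by lia), fst, snd]

lemma fst_d (q : ℤ) : c.fst ≫ P.d p q = 0 := by
  by_cases hpq : p + 1 = q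
  · have := c.hom_d =≫ (mappingCone.fst g).1.v p q hpq
    rwa [Category.assoc, mappingCone.d_fst_v g (p - 1) p q (by lia) hpq, zero_comp,
      Preadditive.comp_neg, neg_eq_zero, ← Category.assoc] at this
  · rw [P.shape _ _ hpq, comp_zero]

lemma snd_d : c.snd ≫ N.d (p - 1) p = -(c.fst ≫ g.f p) := by
  have := c.hom_d =≫ (mappingCone.snd g).v p p (add_zero _)
  rw [Category.assoc, mappingCone.d_snd_v g (p - 1) p (by lia), zero_comp, Preadditive.comp_add,
    ← Category.assoc, ← Category.assoc] at this
  exact eq_neg_of_add_eq_zero_right this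

end Cell

variable [HasCoproducts.{v} C]

variable (G g) in
/-- The coproduct of all cells, as a complex with zero differential. -/
def cellComplex : CochainComplex C ℤ where
  X p := ∐ fun c : Cell G g p => G c.index
  d _ _ := 0

lemma cellComplex_d (p q : ℤ) : (cellComplex G g).d p q = 0 := rfl

/-- The inclusion of a cell. -/
def Cell.inclusion {p : ℤ} (c : Cell G g p) : G c.index ⟶ (cellComplex G g).X p :=
  Sigma.ι (fun c : Cell G g p => G c.index) c

/-- The morphism out of the coproduct of the cells given by a family of morphisms. -/
def cellDesc {p : ℤ} {X : C} (f : ∀ c : Cell G g p, G c.index ⟶ X) : (cellComplex G g).X p ⟶ X :=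
  Sigma.desc f

@[simp]
lemma inclusion_cellDesc {p : ℤ} {X : C} (f : ∀ c : Cell G g p, G c.index ⟶ X) (c : Cell G g p) :
    c.inclusion ≫ cellDesc f = f c :=
  Sigma.ι_desc _ _

lemma cellComplex_hom_ext {p : ℤ} {X : C} {f f' : (cellComplex G g).X p ⟶ X}
    (h : ∀ c : Cell G g p, c.inclusion ≫ f = c.inclusion ≫ f') : f = f' :=
  Sigma.hom_ext _ _ h

lemma isZero_cellComplex_X {p : ℤ} (h : IsZero ((mappingCone g).X (p - 1))) :
    IsZero ((cellComplex G g).X p) :=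
  (IsZero.iff_id_eq_zero _).2 (cellComplex_hom_ext fun c => (c.hom_ne_zero (h.eq_of_tgt _ _)).elim)

lemma isRelSemiprojective_cellComplex : IsRelSemiprojective G (cellComplex G g) :=
  .of_d_eq_zero cellComplex_d fun hA _ => .sigma fun c => hA c.index

variable (G g)

/-- The attaching morphism of the cells. -/
def cellMap : cellComplex G g ⟶ P where
  f p := cellDesc fun c => -c.fst
  comm' p q _ := cellComplex_hom_ext fun c => by
    rw [← Category.assoc, inclusion_cellDesc, Preadditive.neg_comp, c.fst_d, cellComplex_d,
      zero_comp, comp_zero, neg_zero]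

/-- The homotopy trivialising the composition of the attaching morphism with `g`. -/
def cellCochain : Cochain (cellComplex G g) N (-1) :=
  Cochain.mk fun p q hpq => cellDesc fun c => c.hom ≫ (mappingCone.snd g).v (p - 1) q (by lia)

variable {G g}

@[simp]
lemma Cell.inclusion_cellMap {p : ℤ} (c : Cell G g p) :
    c.inclusion ≫ (cellMap G g).f p = -c.fst :=
  inclusion_cellDesc _ c

@[simp]
lemma Cell.inclusion_cellCochain {p : ℤ} (c : Cell G g p) (hp : p + (-1) = p - 1) :
    c.inclusion ≫ (cellCochain G g).v p (p - 1) hp = c.snd :=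
  inclusion_cellDesc _ c

lemma δ_cellCochain : δ (-1) 0 (cellCochain G g) = Cochain.ofHom (cellMap G g ≫ g) := by
  ext p
  refine cellComplex_hom_ext fun c => ?_
  rw [δ_v (-1) 0 (by lia) _ p p (by lia) (p - 1) (p + 1) (by lia) rfl, cellComplex_d, zero_comp,
    smul_zero, add_zero, Cochain.ofHom_v, HomologicalComplex.comp_f, ← Category.assoc,
    ← Category.assoc, c.inclusion_cellCochain, c.inclusion_cellMap, c.snd_d, Preadditive.neg_comp]

variable (G) in
/-- Attaching to a complex over `N` all the cells of its structure morphism. -/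
def attachCells (P : Over N) : Over N :=
  Over.mk (mappingCone.desc (cellMap G P.hom) (cellCochain G P.hom) P.hom δ_cellCochain)

variable (G) in
/-- The inclusion of a complex over `N` in the complex obtained by attaching cells. -/
def toAttachCells (P : Over N) : P ⟶ attachCells G P :=
  Over.homMk (mappingCone.inr (cellMap G P.hom)) (mappingCone.inr_desc _ _ _ δ_cellCochain)

lemma isSplitMono_toAttachCells_f (P : Over N) (p : ℤ) :
    IsSplitMono ((toAttachCells G P).left.f p) :=
  .mk' ⟨(mappingCone.snd (cellMap G P.hom)).v p p (add_zero p), mappingCone.inr_f_snd_v ..⟩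

lemma IsRelSemiprojective.attachCells {P : Over N} (hP : IsRelSemiprojective G P.left) :
    IsRelSemiprojective G (attachCells G P).left :=
  isRelSemiprojective_cellComplex.mappingCone hP _

lemma isZero_attachCells_X {P : Over N} {p : ℤ} (hP : IsZero (P.left.X p))
    (hP' : IsZero (P.left.X (p + 1))) (hN : IsZero (N.X p)) :
    IsZero ((PureResolution.attachCells G P).left.X p) := by
  refine (mappingCone.isZero_X_iff (cellMap G P.hom) p).2 ⟨isZero_cellComplex_X ?_, hP⟩
  rw [add_sub_cancel_right]
  exact (mappingCone.isZero_X_iff P.hom p).2 ⟨hP', hN⟩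

lemma Cell.exists_bound {P : Over N} {p : ℤ} (c : Cell G P.hom p) :
    ∃ y : G c.index ⟶ (mappingCone (attachCells G P).hom).X (p - 1 - 1),
      y ≫ (mappingCone (attachCells G P).hom).d (p - 1 - 1) (p - 1) =
        c.hom ≫ (mappingCone.map P.hom (attachCells G P).hom (toAttachCells G P).left (𝟙 N)
          (by simp)).f (p - 1) := by
  let φ : cellComplex G P.hom ⟶ P.left := cellMap G P.hom
  let f : mappingCone φ ⟶ N := (attachCells G P).hom
  let x : G c.index ⟶ (mappingCone φ).X (p - 1) :=
    c.inclusion ≫ (mappingCone.inl φ).v p (p - 1) (by lia)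
  have hxd : x ≫ (mappingCone φ).d (p - 1) p = -(c.fst ≫ (mappingCone.inr φ).f p) := by
    rw [Category.assoc, mappingCone.inl_v_d φ p (p - 1) (p + 1) (by lia) (by lia), cellComplex_d,
      zero_comp, sub_zero, ← Category.assoc, c.inclusion_cellMap, Preadditive.neg_comp]
  have hxf : x ≫ f.f (p - 1) = c.snd := by
    rw [Category.assoc, ← c.inclusion_cellCochain (by lia)]
    exact c.inclusion ≫= mappingCone.inl_v_desc_f φ _ _ δ_cellCochain p (p - 1) (by lia)
  have hx : (x ≫ (mappingCone.inl f).v (p - 1) (p - 1 - 1) (by lia)) ≫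
      (mappingCone f).d (p - 1 - 1) (p - 1) =
        (c.fst ≫ (mappingCone.inr φ).f p) ≫ (mappingCone.inl f).v p (p - 1) (by lia) +
          (c.snd ≫ 𝟙 (N.X (p - 1))) ≫ (mappingCone.inr f).f (p - 1) := by
    rw [Category.assoc, mappingCone.inl_v_d f (p - 1) (p - 1 - 1) p (by lia) (by lia),
      Preadditive.comp_sub, ← Category.assoc, ← Category.assoc, hxd, hxf, Preadditive.neg_comp,
      sub_neg_eq_add, add_comm, Category.comp_id]
  refine ⟨_, hx.trans ?_⟩
  rw [c.hom_eq, decomp_comp_map_f P.hom _ _ _ _ (by lia)]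
  rfl

lemma exists_bound {P : Over N} {i j k : ℤ} (hij : i + 1 = j) (hjk : j + 1 = k) {a : ι}
    (x : G a ⟶ (mappingCone P.hom).X j) (hx : x ≫ (mappingCone P.hom).d j k = 0) :
    ∃ y : G a ⟶ (mappingCone (attachCells G P).hom).X i,
      y ≫ (mappingCone (attachCells G P).hom).d i j =
        x ≫ (mappingCone.map P.hom (attachCells G P).hom (toAttachCells G P).left (𝟙 N)
          (by simp)).f j := by
  obtain rfl : j = k - 1 := by lia
  obtain rfl : i = k - 1 - 1 := by lia
  obtain rfl | hx₀ := eq_or_ne x 0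
  · exact ⟨0, by rw [zero_comp, zero_comp]⟩
  · exact Cell.exists_bound ⟨a, x, hx, hx₀⟩

section Sequence

variable (G) (P : Over N)

/-- The complex obtained from `P` by attaching cells `n` times. -/
def cellSequence : ℕ → Over N
  | 0 => P
  | n + 1 => attachCells G (cellSequence n)

/-- The direct system obtained from `P` by attaching cells repeatedly. -/
def cellSystem : ℕ ⥤ Over N :=
  Functor.ofSequence fun n => toAttachCells G (cellSequence G P n)

/-- The direct system obtained from `P` by attaching cells, as a cocone over `N`. -/
def cellCocone : Cocone (cellSystem G P ⋙ Over.forget N) :=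
  (Over.forgetCocone N).whisker (cellSystem G P)

lemma cellSystem_map_succ_left (n : ℕ) :
    ((cellSystem G P).map (homOfLE n.le_succ)).left =
      (toAttachCells G (cellSequence G P n)).left :=
  congrArg Over.Hom.left
    (Functor.ofSequence_map_homOfLE_succ (fun n => toAttachCells G (cellSequence G P n)) n)

lemma mappingConeDiagram_map_cellCocone_ι (n : ℕ) :
    (mappingConeDiagram (cellCocone G P).ι).map (homOfLE n.le_succ) =
      mappingCone.map (cellSequence G P n).hom (attachCells G (cellSequence G P n)).hom
        (toAttachCells G (cellSequence G P n)).left (𝟙 N) (by simp) := by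
  have h := cellSystem_map_succ_left G P n
  rw [mappingConeDiagram_map]
  congr 1

variable {G P}

lemma isRelSemiprojective_cellSequence (hP : IsRelSemiprojective G P.left) :
    ∀ n, IsRelSemiprojective G (cellSequence G P n).left
  | 0 => hP
  | n + 1 => (isRelSemiprojective_cellSequence hP n).attachCells

lemma isZero_cellSequence_X {b : ℤ} (hP : ∀ p, b < p → IsZero (P.left.X p))
    (hN : ∀ p, b < p → IsZero (N.X p)) :
    ∀ (n : ℕ) (p : ℤ), b < p → IsZero ((cellSequence G P n).left.X p)
  | 0 => hP
  | n + 1 => fun p hp => isZero_attachCells_X (isZero_cellSequence_X hP hN n p hp)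
      (isZero_cellSequence_X hP hN n (p + 1) (by lia)) (hN p hp)

variable {c : Cocone (cellSystem G P ⋙ Over.forget N)}

lemma isRelAcyclic_mappingCone_desc_cellCocone (hG : ∀ a, IsSequentiallySmall (G a))
    (hc : IsColimit c) : IsRelAcyclic G (mappingCone (hc.desc (cellCocone G P))) := fun a =>
  ((hG a _ c hc).mappingCone (cellCocone G P).ι (.const N) _
    fun n => (Category.comp_id _).trans (hc.fac (cellCocone G P) n).symm).isHomAcyclic
    fun n i j k hij hjk x hx => by
      obtain ⟨y, hy⟩ := exists_bound hij hjk x hx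
      exact ⟨n + 1, homOfLE n.le_succ, y, hy.trans (x ≫= HomologicalComplex.congr_hom
        (mappingConeDiagram_map_cellCocone_ι G P n).symm j)⟩

end Sequence

end Cells

section Resolution

variable [HasBinaryBiproducts C]

variable (G) in
/-- A resolution relative to the test objects `G`: a morphism from a semi-projective complex whose
mapping cone is acyclic relative to `G`. -/
structure IsRelResolution {P N : CochainComplex C ℤ} (g : P ⟶ N) : Prop where
  isRelSemiprojective : IsRelSemiprojective G P
  isRelAcyclic_mappingCone : IsRelAcyclic G (mappingCone g)

lemma IsRelResolution.of_isColimit [HasColimitsOfShape ℕ C] {P N : ℕ ⥤ CochainComplex C ℤ}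
    {φ : P ⟶ N} {c : Cocone P} (hc : IsColimit c) {d : Cocone N}
    (hP : ∀ a, IsHomColimit (G a) P c.ι.app) (hN : ∀ a, IsHomColimit (G a) N d.ι.app)
    (hφ : ∀ n, IsRelResolution G (φ.app n))
    (hs : ∀ (n : ℕ) (p : ℤ), IsSplitMono ((P.map (homOfLE n.le_succ)).f p)) :
    IsRelResolution G (hc.desc ((Cocone.precompose φ).obj d)) where
  isRelSemiprojective := .of_isColimit hc (fun n => (hφ n).isRelSemiprojective) hs
  isRelAcyclic_mappingCone a :=
    ((hP a).mappingCone φ (hN a) _ fun n =>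
      (hc.fac ((Cocone.precompose φ).obj d) n).symm).isHomAcyclic_of_obj fun n =>
        (hφ n).isRelAcyclic_mappingCone a

variable [HasCoproducts.{v} C] [HasColimitsOfShape ℕ C]

lemma exists_isRelResolution_comp_eq (hG : ∀ a, IsSequentiallySmall (G a))
    {K N : CochainComplex C ℤ} (hK : IsRelSemiprojective G K) (g : K ⟶ N) {b : ℤ}
    (hKb : ∀ p, b < p → IsZero (K.X p)) (hNb : ∀ p, b < p → IsZero (N.X p)) :
    ∃ (P : CochainComplex C ℤ) (i : K ⟶ P) (f : P ⟶ N), i ≫ f = g ∧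
      (∀ p, IsSplitMono (i.f p)) ∧ IsRelResolution G f ∧ ∀ p, b < p → IsZero (P.X p) := by
  let X := cellSystem G (Over.mk g) ⋙ Over.forget N
  let hc := colimit.isColimit X
  let hcp (p : ℤ) := isColimitOfPreserves (HomologicalComplex.eval C (ComplexShape.up ℤ) p) hc
  have hs (n : ℕ) (p : ℤ) : IsSplitMono ((X.map (homOfLE n.le_succ)).f p) := by
    rw [show X.map (homOfLE n.le_succ) = _ from cellSystem_map_succ_left G (Over.mk g) n]
    exact isSplitMono_toAttachCells_f _ p
  exact ⟨colimit X, colimit.ι X 0, hc.desc (cellCocone G _), hc.fac _ 0,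
    fun p => isSplitMono_ι_zero (hcp p) fun n => hs n p,
    ⟨.of_isColimit hc (isRelSemiprojective_cellSequence hK) hs,
      isRelAcyclic_mappingCone_desc_cellCocone hG hc⟩,
    fun p hp => isZero_of_isColimit (hcp p) fun n => isZero_cellSequence_X hKb hNb n p hp⟩

lemma exists_isRelResolution_sequence [HasZeroObject C] (hG : ∀ a, IsSequentiallySmall (G a))
    (N : ℕ ⥤ CochainComplex C ℤ) {b : ℕ → ℤ} (hb : Monotone b)
    (hN : ∀ n p, b n < p → IsZero ((N.obj n).X p)) :
    ∃ (P : ℕ ⥤ CochainComplex C ℤ) (φ : P ⟶ N),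
      (∀ (n : ℕ) (p : ℤ), IsSplitMono ((P.map (homOfLE n.le_succ)).f p)) ∧
      (∀ n, IsRelResolution G (φ.app n)) ∧ ∀ n p, b n < p → IsZero ((P.obj n).X p) := by
  obtain ⟨P, hP⟩ := exists_seq (T := fun n => Over (N.obj n))
    (fun n P => IsRelResolution G P.hom ∧ ∀ p, b n < p → IsZero (P.left.X p))
    (fun n P P' => ∃ i : P.left ⟶ P'.left,
      i ≫ P'.hom = P.hom ≫ N.map (homOfLE n.le_succ) ∧ ∀ p, IsSplitMono (i.f p)) (by
      obtain ⟨P, _, f, _, _, hf, hb⟩ := exists_isRelResolution_comp_eq hG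
        (.of_isZero (isZero_zero (CochainComplex C ℤ))) (0 : _ ⟶ N.obj 0)
        (fun p _ => (HomologicalComplex.eval C _ p).map_isZero (isZero_zero _)) (hN 0)
      exact ⟨Over.mk f, hf, hb⟩) (by
      intro n P ⟨hP, hPb⟩
      obtain ⟨P', i, f, hif, hi, hf, hb'⟩ := exists_isRelResolution_comp_eq hG
        hP.isRelSemiprojective (P.hom ≫ N.map (homOfLE n.le_succ))
        (fun p hp => hPb p ((hb n.le_succ).trans_lt hp)) (hN (n + 1))
      exact ⟨Over.mk f, ⟨hf, hb'⟩, i, hif, hi⟩)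
  choose i hi hs using fun n => (hP n).2
  refine ⟨Functor.ofSequence i, NatTrans.ofSequence (fun n => (P n).hom) fun n => ?_, ?_,
    fun n => (hP n).1.1, fun n => (hP n).1.2⟩
  · rw [Functor.ofSequence_map_homOfLE_succ]
    exact hi n
  · intro n
    rw [Functor.ofSequence_map_homOfLE_succ]
    exact hs n

end Resolution

end Relative

section Purity

open TensorProduct

variable {R : Type u} [CommRing R] {A : Type v} [AddCommGroup A] [Module R A]

/-- A submodule `K` of `A` is pure if `N ⊗ K ⟶ N ⊗ A` is injective for every module `N`. -/
def IsPure (K : Submodule R A) : Prop :=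
  ∀ (N : Type u) [AddCommGroup N] [Module R N], Function.Injective (K.subtype.lTensor N)

variable {K : Submodule R A}

lemma IsPure.exists_extension (hK : IsPure K) {X Y : Type u} [AddCommGroup X] [Module R X]
    [Module.Finite R X] [Module.Projective R X] [AddCommGroup Y] [Module R Y] [Module.Finite R Y]
    [Module.Projective R Y] (g : X →ₗ[R] Y) (y : Y →ₗ[R] A) (w : X →ₗ[R] K)
    (h : y ∘ₗ g = K.subtype ∘ₗ w) : ∃ b : Y →ₗ[R] K, b ∘ₗ g = w := by
  -- Through `Hom(X, A) ≃ X* ⊗ A`, the hypothesis says that the image of `ω` in `coker g* ⊗ K`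
  -- vanishes in `coker g* ⊗ A`, hence vanishes by purity.
  obtain ⟨ω, rfl⟩ := dualTensorHom_bijective.surjective w
  obtain ⟨η, rfl⟩ := dualTensorHom_bijective.surjective y
  have hη : g.dualMap.rTensor A η = K.subtype.lTensor _ ω := by
    refine dualTensorHom_bijective.injective ?_
    exact (LinearMap.congr_fun (dualTensorHom_comp_rTensor_dualMap g) η).trans
      (h.trans (LinearMap.congr_fun (dualTensorHom_comp_lTensor K.subtype) ω).symm)
  have hexact (B : Type _) [AddCommGroup B] [Module R B] :
      Function.Exact (g.dualMap.rTensor B) ((LinearMap.range g.dualMap).mkQ.rTensor B) :=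
    rTensor_exact B (LinearMap.exact_map_mkQ_range _) (Submodule.mkQ_surjective _)
  obtain ⟨β, hβ⟩ := (hexact K ω).1 <| hK _ <| by
    rw [map_zero, ← LinearMap.comp_apply, LinearMap.lTensor_comp_rTensor,
      ← LinearMap.rTensor_comp_lTensor, LinearMap.comp_apply, ← hη]
    exact (hexact A _).2 ⟨η, rfl⟩
  refine ⟨dualTensorHom R _ _ β, ?_⟩
  rw [← hβ]
  exact (LinearMap.congr_fun (dualTensorHom_comp_rTensor_dualMap g) β).symm

lemma exists_eq_sum_tmul_of_span_eq_top {N B ι : Type*} [AddCommGroup N] [Module R N]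
    [AddCommGroup B] [Module R B] [Fintype ι] {m : ι → N}
    (hm : Submodule.span R (Set.range m) = ⊤) (x : N ⊗[R] B) :
    ∃ n : ι → B, x = ∑ i, m i ⊗ₜ n i := by
  induction x with
  | zero => exact ⟨0, by simp⟩
  | tmul a b =>
    obtain ⟨c, rfl⟩ := (Submodule.mem_span_range_iff_exists_fun R).1
      (show a ∈ Submodule.span R (Set.range m) by simp [hm])
    exact ⟨fun i => c i • b, by simp [sum_tmul, smul_tmul]⟩
  | add a b ha hb =>
    obtain ⟨p, rfl⟩ := ha
    obtain ⟨q, rfl⟩ := hb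
    exact ⟨p + q, by simp [tmul_add, Finset.sum_add_distrib]⟩

lemma injective_lTensor_of_forall_fg {B B' : Type*} [AddCommGroup B] [Module R B] [AddCommGroup B']
    [Module R B'] (f : B →ₗ[R] B') {N : Type*} [AddCommGroup N] [Module R N]
    (hf : ∀ Q : Submodule R N, Q.FG → Function.Injective (f.lTensor Q)) :
    Function.Injective (f.lTensor N) := by
  rw [injective_iff_map_eq_zero]
  intro z hz
  obtain ⟨P, hP, t, rfl⟩ := TensorProduct.exists_of_fg z
  rw [← LinearMap.comp_apply, LinearMap.lTensor_comp_rTensor, ← LinearMap.rTensor_comp_lTensor,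
    LinearMap.comp_apply] at hz
  obtain ⟨Q, hPQ, hQ, h⟩ := TensorProduct.eq_zero_of_fg_of_subtype_eq_zero hP hz
  rw [← LinearMap.comp_apply, LinearMap.rTensor_comp_lTensor, ← LinearMap.lTensor_comp_rTensor,
    LinearMap.comp_apply] at h
  rw [← Submodule.subtype_comp_inclusion P Q hPQ, LinearMap.rTensor_comp, LinearMap.comp_apply,
    (injective_iff_map_eq_zero _).1 (hf Q hQ) _ h, map_zero]

lemma isPure_of_exists_extension
    (h : ∀ {m n : ℕ} (g : (Fin m → R) →ₗ[R] (Fin n → R)) (y : (Fin n → R) →ₗ[R] A)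
      (w : (Fin m → R) →ₗ[R] K), y ∘ₗ g = K.subtype ∘ₗ w →
        ∃ b : (Fin n → R) →ₗ[R] K, b ∘ₗ g = w) : IsPure K := by
  intro N _ _
  refine injective_lTensor_of_forall_fg _ fun Q hQ => (injective_iff_map_eq_zero _).2 fun z hz => ?_
  obtain ⟨m, q, hq⟩ := Submodule.fg_iff_exists_fin_generating_family.1
    (Module.Finite.fg_top (R := R) (M := Q) (self := Module.Finite.iff_fg.2 hQ))
  obtain ⟨k, rfl⟩ := exists_eq_sum_tmul_of_span_eq_top hq z
  obtain ⟨n, r, a, hka, hqr⟩ := vanishesTrivially_of_sum_tmul_eq_zero R hq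
    (n := fun i => (k i : A)) (by simpa using hz)
  obtain ⟨b, hb⟩ := h (Fintype.linearCombination R r) (Fintype.linearCombination R a)
    (Fintype.linearCombination R k) (by ext i; simp [hka, Fintype.linearCombination_apply])
  refine sum_tmul_eq_zero_of_vanishesTrivially R
    ⟨n, r, fun j => b (Pi.single j 1), fun i => ?_, hqr⟩
  have hbk : b (r i) = k i := by simpa using LinearMap.congr_fun hb (Pi.single i 1)
  conv_lhs => rw [← hbk, pi_eq_sum_univ' (r i)]
  simp only [map_sum, map_smul]

lemma IsPure.exists_lift (hK : IsPure K) {F : Type*} [AddCommGroup F] [Module R F]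
    [Module.FinitePresentation R F] (x : F →ₗ[R] A ⧸ K) : ∃ y : F →ₗ[R] A, K.mkQ ∘ₗ y = x := by
  obtain ⟨n, m, f, g, hf, hfg⟩ := Module.FinitePresentation.exists_fin' R F
  obtain ⟨y, hy⟩ := Module.projective_lifting_property K.mkQ (x ∘ₗ f) K.mkQ_surjective
  have hyg (v : Fin m → R) : y (g v) ∈ K := by
    rw [← K.ker_mkQ, LinearMap.mem_ker, ← LinearMap.comp_apply, hy, LinearMap.comp_apply,
      hfg.apply_apply_eq_zero, map_zero]
  obtain ⟨b, hb⟩ := hK.exists_extension g y ((y ∘ₗ g).codRestrict K hyg) rfl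
  have hyb : (y - K.subtype ∘ₗ b) ∘ₗ g = 0 := by
    ext v
    simpa [sub_eq_zero] using congrArg Subtype.val (LinearMap.congr_fun hb (Pi.single v 1)).symm
  obtain ⟨t, ht⟩ :=
    (LinearMap.exact_lcomp_of_exact_of_surjective A hfg hf (y - K.subtype ∘ₗ b)).1 hyb
  refine ⟨t, (LinearMap.cancel_right hf).1 ?_⟩
  rw [← hy, LinearMap.comp_assoc]
  ext v
  simp [show t ∘ₗ f = _ from ht]

lemma finitePresentation_quotient_range {m n : ℕ} (g : (Fin m → R) →ₗ[R] (Fin n → R)) :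
    Module.FinitePresentation R ((Fin n → R) ⧸ LinearMap.range g) :=
  Module.finitePresentation_of_surjective _ (Submodule.mkQ_surjective _) <| by
    rw [Submodule.ker_mkQ]
    exact Module.Finite.iff_fg.1 inferInstance

lemma isPure_of_exists_lift
    (h : ∀ (F : Type u) [AddCommGroup F] [Module R F] [Module.FinitePresentation R F]
      (x : F →ₗ[R] A ⧸ K), ∃ y : F →ₗ[R] A, K.mkQ ∘ₗ y = x) : IsPure K := by
  refine isPure_of_exists_extension fun {m n} g y w hw => ?_
  have hyg : LinearMap.range g ≤ LinearMap.ker (K.mkQ ∘ₗ y) := by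
    rintro _ ⟨v, rfl⟩
    simpa using (LinearMap.congr_fun hw v).symm ▸ (w v).2
  have : Module.FinitePresentation R ((Fin n → R) ⧸ LinearMap.range g) :=
    finitePresentation_quotient_range g
  obtain ⟨t, ht⟩ := h _ ((LinearMap.range g).liftQ _ hyg)
  have hmem (v : Fin n → R) : (y - t ∘ₗ (LinearMap.range g).mkQ) v ∈ K := by
    rw [← Submodule.Quotient.mk_eq_zero]
    simpa [sub_eq_zero] using (LinearMap.congr_fun ht (Submodule.Quotient.mk v)).symm
  refine ⟨LinearMap.codRestrict K _ hmem, LinearMap.ext fun v => Subtype.ext ?_⟩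
  have hgv : (LinearMap.range g).mkQ (g v) = 0 := (Submodule.Quotient.mk_eq_zero _).2 ⟨v, rfl⟩
  have hyv : y (g v) = w v := LinearMap.congr_fun hw v
  simp [hyv, hgv, -Submodule.mkQ_apply]

section Exact

variable {B C : Type*} [AddCommGroup B] [Module R B] [AddCommGroup C] [Module R C]
  {f : A →ₗ[R] B} {g : B →ₗ[R] C}

lemma exact_lTensor_iff (hfg : Function.Exact f g) (N : Type*) [AddCommGroup N] [Module R N] :
    Function.Exact (f.lTensor N) (g.lTensor N) ↔
      Function.Injective ((LinearMap.range g).subtype.lTensor N) := by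
  have hsurj := LinearMap.lTensor_surjective N g.surjective_rangeRestrict
  have hexact : Function.Exact (f.lTensor N) (g.rangeRestrict.lTensor N) :=
    lTensor_exact N (fun x => by rw [← hfg x, ← Subtype.val_inj]; rfl) g.surjective_rangeRestrict
  have hcomp : g.lTensor N = (LinearMap.range g).subtype.lTensor N ∘ₗ g.rangeRestrict.lTensor N :=
    LinearMap.lTensor_comp N (LinearMap.range g).subtype g.rangeRestrict
  rw [hcomp, LinearMap.coe_comp]
  refine ⟨fun h => (injective_iff_map_eq_zero _).2 fun z hz => ?_, fun h x => ?_⟩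
  · obtain ⟨x, rfl⟩ := hsurj z
    exact (hexact x).2 ((h x).1 hz)
  · rw [← hexact x, Function.comp_apply, map_eq_zero_iff _ h]

lemma isPure_range_iff_exact_lTensor (hfg : Function.Exact f g) :
    IsPure (LinearMap.range g) ↔ ∀ (N : Type u) [AddCommGroup N] [Module R N],
      Function.Exact (f.lTensor N) (g.lTensor N) :=
  forall_congr' fun N => forall₂_congr fun _ _ => (exact_lTensor_iff hfg N).symm

lemma isPure_ker_iff_exists_lift (hfg : Function.Exact f g) :
    IsPure (LinearMap.ker f) ↔
      ∀ (F : Type u) [AddCommGroup F] [Module R F] [Module.FinitePresentation R F]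
        (x : F →ₗ[R] B), g ∘ₗ x = 0 → ∃ y : F →ₗ[R] A, f ∘ₗ y = x := by
  let e : (A ⧸ LinearMap.ker f) →ₗ[R] B := (LinearMap.ker f).liftQ f le_rfl
  have he : Function.Injective e := LinearMap.ker_eq_bot.1 (Submodule.ker_liftQ_eq_bot' _ _ rfl)
  have hef : e ∘ₗ (LinearMap.ker f).mkQ = f := Submodule.liftQ_mkQ _ _ _
  refine ⟨fun h F _ _ _ x hx => ?_, fun h => isPure_of_exists_lift fun F _ _ _ x => ?_⟩
  · have hxe (z : F) : x z ∈ LinearMap.range e := by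
      obtain ⟨a, ha⟩ := (hfg (x z)).1 (LinearMap.congr_fun hx z)
      exact ⟨(LinearMap.ker f).mkQ a, (LinearMap.congr_fun hef a).trans ha⟩
    obtain ⟨y, hy⟩ := h.exists_lift
      ((LinearEquiv.ofInjective e he).symm.toLinearMap ∘ₗ x.codRestrict _ hxe)
    refine ⟨y, ?_⟩
    rw [← hef, LinearMap.comp_assoc, hy]
    ext z
    exact congrArg Subtype.val ((LinearEquiv.ofInjective e he).apply_symm_apply _)
  · obtain ⟨y, hy⟩ := h F (e ∘ₗ x) <| by
      ext z
      obtain ⟨a, ha⟩ := (LinearMap.ker f).mkQ_surjective (x z)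
      rw [LinearMap.comp_apply, LinearMap.comp_apply, ← ha]
      exact hfg.apply_apply_eq_zero a
    exact ⟨y, LinearMap.ext fun z => he (LinearMap.congr_fun hy z)⟩

end Exact

end Purity

section PureAcyclic

variable {R : Type u} [CommRing R]

lemma acyclic_iff_exact (A : CochainComplex (ModuleCat.{u} R) ℤ) :
    A.Acyclic ↔ ∀ i j k : ℤ, i + 1 = j → j + 1 = k →
      Function.Exact (A.d i j).hom (A.d j k).hom := by
  refine ⟨fun h i j k hij hjk => ?_, fun h j => ?_⟩
  · exact (ShortComplex.ShortExact.moduleCat_exact_iff_function_exact (A.sc' i j k)).1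
      ((A.exactAt_iff' i j k (by simp [← hij]) (by simp [← hjk])).1 (h j))
  · rw [A.exactAt_iff' (j - 1) j (j + 1) (by simp) (by simp)]
    exact (ShortComplex.ShortExact.moduleCat_exact_iff_function_exact _).2
      (h (j - 1) j (j + 1) (by lia) rfl)

lemma isHomAcyclic_iff_exists_comp_eq (F : ModuleCat.{u} R)
    (A : CochainComplex (ModuleCat.{u} R) ℤ) :
    IsHomAcyclic F A ↔ ∀ i j k : ℤ, i + 1 = j → j + 1 = k → ∀ x : F →ₗ[R] A.X j,
      (A.d j k).hom ∘ₗ x = 0 → ∃ y : F →ₗ[R] A.X i, (A.d i j).hom ∘ₗ y = x := by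
  refine forall₃_congr fun i j k => forall₂_congr fun _ _ => ?_
  refine ⟨fun h x hx => ?_, fun h x hx => ?_⟩
  · obtain ⟨y, hy⟩ := h (ModuleCat.ofHom x) (ModuleCat.hom_ext hx)
    exact ⟨y.hom, congrArg ModuleCat.Hom.hom hy⟩
  · obtain ⟨y, hy⟩ := h x.hom (congrArg ModuleCat.Hom.hom hx)
    exact ⟨ModuleCat.ofHom y, ModuleCat.hom_ext hy⟩

lemma isPureAcyclic_iff_isPure_range (A : CochainComplex (ModuleCat.{u} R) ℤ) :
    IsPureAcyclic A ↔ A.Acyclic ∧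
      ∀ j k : ℤ, j + 1 = k → IsPure (LinearMap.range (A.d j k).hom) := by
  have htensor : IsPureAcyclic A ↔ ∀ (N : Type u) [AddCommGroup N] [Module R N] (i j k : ℤ),
      i + 1 = j → j + 1 = k →
        Function.Exact ((A.d i j).hom.lTensor N) ((A.d j k).hom.lTensor N) :=
    ⟨fun h N _ _ => (acyclic_iff_exact _).1 (h (ModuleCat.of R N)),
      fun h N => (acyclic_iff_exact _).2 (h N)⟩
  rw [htensor, acyclic_iff_exact]
  refine ⟨fun h => ?_, fun ⟨hA, h⟩ N _ _ i j k hij hjk =>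
    (isPure_range_iff_exact_lTensor (hA i j k hij hjk)).1 (h j k hjk) N⟩
  have hlid (j k : ℤ) : (A.d j k).hom ∘ₗ (TensorProduct.lid R (A.X j)).toLinearMap =
      (TensorProduct.lid R (A.X k)).toLinearMap ∘ₗ (A.d j k).hom.lTensor R :=
    TensorProduct.ext' fun r a => by simp
  have hA (i j k : ℤ) (hij : i + 1 = j) (hjk : j + 1 = k) :
      Function.Exact (A.d i j).hom (A.d j k).hom :=
    (Function.Exact.iff_of_ladder_linearEquiv (hlid i j) (hlid j k)).2 (h R i j k hij hjk)
  exact ⟨hA, fun j k hjk => (isPure_range_iff_exact_lTensor (hA (j - 1) j k (by lia) hjk)).2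
    fun N _ _ => h N (j - 1) j k (by lia) hjk⟩

lemma forall_isHomAcyclic_iff_isPure_ker (A : CochainComplex (ModuleCat.{u} R) ℤ) :
    (∀ (F : ModuleCat.{u} R) [Module.FinitePresentation R F], IsHomAcyclic F A) ↔
      A.Acyclic ∧ ∀ i j : ℤ, i + 1 = j → IsPure (LinearMap.ker (A.d i j).hom) := by
  simp only [isHomAcyclic_iff_exists_comp_eq, acyclic_iff_exact]
  refine ⟨fun h => ?_, fun ⟨hA, h⟩ F _ i j k hij hjk =>
    (isPure_ker_iff_exists_lift (hA i j k hij hjk)).1 (h i j hij) F⟩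
  have hA (i j k : ℤ) (hij : i + 1 = j) (hjk : j + 1 = k) :
      Function.Exact (A.d i j).hom (A.d j k).hom := by
    refine fun x => ⟨fun hx => ?_, ?_⟩
    · obtain ⟨y, hy⟩ := h (ModuleCat.of R R) i j k hij hjk (LinearMap.toSpanSingleton R _ x)
        (LinearMap.ext_ring (by simpa using hx))
      exact ⟨y 1, by simpa using LinearMap.congr_fun hy 1⟩
    · rintro ⟨y, rfl⟩
      exact ConcreteCategory.congr_hom (A.d_comp_d i j k) y
  exact ⟨hA, fun i j hij => (isPure_ker_iff_exists_lift (hA i j (j + 1) hij rfl)).2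
    fun F _ _ _ => h (ModuleCat.of R F) i j (j + 1) hij rfl⟩

theorem isPureAcyclic_iff_isHomAcyclic (A : CochainComplex (ModuleCat.{u} R) ℤ) :
    IsPureAcyclic A ↔
      ∀ (F : ModuleCat.{u} R) [Module.FinitePresentation R F], IsHomAcyclic F A := by
  rw [isPureAcyclic_iff_isPure_range, forall_isHomAcyclic_iff_isPure_ker]
  refine and_congr_right fun hA => ?_
  have hrange (i j k : ℤ) (hij : i + 1 = j) (hjk : j + 1 = k) :
      LinearMap.ker (A.d j k).hom = LinearMap.range (A.d i j).hom :=
    ((acyclic_iff_exact A).1 hA i j k hij hjk).linearMap_ker_eq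
  refine ⟨fun h i j hij => ?_, fun h i j hij => ?_⟩
  · rw [hrange (i - 1) i j (by lia) hij]
    exact h _ _ (by lia)
  · rw [← hrange i j (j + 1) hij rfl]
    exact h _ _ rfl

end PureAcyclic

section FinitelyPresented

lemma isSequentiallySmall_of_isFinitelyPresentable {C : Type w} [Category.{v} C] [Preadditive C]
    [HasColimitsOfShape ℕ C] (F : C) [IsFinitelyPresentable.{v} F] : IsSequentiallySmall F := by
  intro X c hc
  have := preservesFilteredColimitsOfSize_shrink.{0, v, 0, v} (coyoneda.obj (op F))
  have hcp (p : ℤ) := isColimitOfPreserves (HomologicalComplex.eval _ _ p ⋙ coyoneda.obj (op F)) hc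
  refine ⟨fun f => c.w f, fun p x => Types.jointly_surjective_of_isColimit (hcp p) x,
    fun p n x hx => ?_⟩
  obtain ⟨m, f, hf⟩ := (Types.FilteredColimit.isColimit_eq_iff' (hcp p) x (0 : F ⟶ (X.obj n).X p)).1
    (hx.trans zero_comp.symm)
  exact ⟨m, f, hf.trans zero_comp⟩

variable {R : Type u} [CommRing R]

variable (R) in
lemma isFinitelyPresentable_pi (n : ℕ) :
    IsFinitelyPresentable.{u} (ModuleCat.of R (Fin n → R)) := by
  have := Cardinal.fact_isRegular_aleph0.{u}
  have : (forget (ModuleCat.{u} R)).IsCardinalAccessible Cardinal.aleph0.{u} :=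
    Functor.isFinitelyAccessible_iff_preservesFilteredColimits.2 inferInstance
  have : IsCardinalPresentable (ULift.{u} (Fin n)) Cardinal.aleph0.{u} :=
    (hasCardinalLT_of_finite _ _ le_rfl).isCardinalPresentable
  have : IsCardinalPresentable (ModuleCat.of R (ULift.{u} (Fin n) →₀ R)) Cardinal.aleph0.{u} :=
    (ModuleCat.adj R).isCardinalPresentable_leftAdjoint_obj _ (ULift.{u} (Fin n))
  exact isCardinalPresentable_of_iso ((Finsupp.linearEquivFunOnFinite R R (ULift.{u} (Fin n))).trans
    (LinearEquiv.funCongrLeft R R Equiv.ulift.symm)).toModuleIso _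

lemma isFinitelyPresentable_of_finitePresentation (F : ModuleCat.{u} R)
    [Module.FinitePresentation R F] : IsFinitelyPresentable.{u} F := by
  obtain ⟨n, m, f, g, hf, hfg⟩ := Module.FinitePresentation.exists_fin' R F
  have := Cardinal.fact_isRegular_aleph0.{u}
  have hpair : ∀ k, IsFinitelyPresentable.{u}
      ((parallelPair (ModuleCat.ofHom g) 0).obj k) := by
    rintro (_ | _)
    exacts [isFinitelyPresentable_pi R m, isFinitelyPresentable_pi R n]
  exact isCardinalPresentable_of_isColimit _
    (ModuleCat.isColimitCokernelCofork (ModuleCat.ofHom g) (ModuleCat.ofHom f) hfg hf) _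
    (hasCardinalLT_of_finite _ _ le_rfl)

variable (R) in
/-- A matrix of relations presenting a module. These matrices form a small set, which makes them
index a small family of representatives of all finitely presented modules. -/
structure FinPresentation where
  rank : ℕ
  card : ℕ
  relations : (Fin card → R) →ₗ[R] (Fin rank → R)

/-- The module presented by a matrix of relations. -/
def FinPresentation.module (S : FinPresentation R) : ModuleCat.{u} R :=
  ModuleCat.of R ((Fin S.rank → R) ⧸ LinearMap.range S.relations)

instance (S : FinPresentation R) : Module.FinitePresentation R S.module :=
  finitePresentation_quotient_range S.relations

lemma exists_finPresentation_iso (F : ModuleCat.{u} R) [Module.FinitePresentation R F] :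
    ∃ S : FinPresentation R, Nonempty (S.module ≅ F) := by
  obtain ⟨n, m, f, g, hf, hfg⟩ := Module.FinitePresentation.exists_fin' R F
  exact ⟨⟨n, m, g⟩, ⟨((Submodule.quotEquivOfEq _ _ hfg.linearMap_ker_eq.symm).trans
    (f.quotKerEquivOfSurjective hf)).toModuleIso⟩⟩

lemma isPureAcyclic_iff_isRelAcyclic (A : CochainComplex (ModuleCat.{u} R) ℤ) :
    IsPureAcyclic A ↔ IsRelAcyclic FinPresentation.module A := by
  rw [isPureAcyclic_iff_isHomAcyclic]
  refine ⟨fun h S => h S.module, fun h F _ => ?_⟩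
  obtain ⟨S, ⟨e⟩⟩ := exists_finPresentation_iso F
  exact (h S).of_iso e

end FinitelyPresented

section HomTensor

open TensorProduct

lemma isHomAcyclic_iff_of_adjunction {C D : Type*} [Category* C] [Category* D] [Preadditive C]
    [Preadditive D] {G : C ⥤ D} {H : D ⥤ C} [H.Additive] (adj : G ⊣ H) (X : C)
    (A : CochainComplex D ℤ) :
    IsHomAcyclic X ((H.mapHomologicalComplex _).obj A) ↔ IsHomAcyclic (G.obj X) A := by
  refine forall₃_congr fun i j k => forall₂_congr fun _ _ =>
    ((adj.homEquiv X (A.X j)).forall_congr fun x => imp_congr ?_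
      ((adj.homEquiv X (A.X i)).exists_congr fun y => ?_)).symm
  · have hzero : adj.homEquiv X (A.X k) 0 = 0 := by simp [Adjunction.homEquiv_unit]
    rw [← (adj.homEquiv X (A.X k)).apply_eq_iff_eq, adj.homEquiv_naturality_right, hzero]
    rfl
  · rw [← (adj.homEquiv X (A.X j)).apply_eq_iff_eq, adj.homEquiv_naturality_right]
    rfl

variable {R : Type u} [CommRing R]

lemma finitePresentation_tensorProduct (M N : Type u) [AddCommGroup M] [Module R M]
    [AddCommGroup N] [Module R N] [Module.FinitePresentation R M] [Module.FinitePresentation R N] :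
    Module.FinitePresentation R (M ⊗[R] N) := by
  obtain ⟨n, m, f, g, hf, hfg⟩ := Module.FinitePresentation.exists_fin' R M
  have : Module.FinitePresentation R ((Fin n → R) ⊗[R] N) :=
    Module.FinitePresentation.of_equiv
      ((TensorProduct.comm R _ _ ≪≫ₗ TensorProduct.piScalarRight R R N (Fin n)).symm)
  refine Module.finitePresentation_of_surjective (f.rTensor N)
    (LinearMap.rTensor_surjective N hf) ?_
  rw [(rTensor_exact N hfg hf).linearMap_ker_eq]
  exact Module.Finite.iff_fg.1 inferInstance

lemma isHomAcyclic_moduleHomComplex_iff (X F : ModuleCat.{u} R)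
    (A : CochainComplex (ModuleCat.{u} R) ℤ) :
    IsHomAcyclic X (moduleHomComplex F A) ↔ IsHomAcyclic (MonoidalCategory.tensorObj F X) A :=
  isHomAcyclic_iff_of_adjunction (H := (linearCoyoneda R (ModuleCat.{u} R)).obj (op F))
    (ihom.adjunction F) X A

lemma IsPureAcyclic.moduleHomComplex {A : CochainComplex (ModuleCat.{u} R) ℤ}
    (hA : IsPureAcyclic A) (F : ModuleCat.{u} R) [Module.FinitePresentation R F] :
    IsPureAcyclic (moduleHomComplex F A) := by
  rw [isPureAcyclic_iff_isHomAcyclic] at hA ⊢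
  intro G _
  have := finitePresentation_tensorProduct (R := R) F G
  exact (isHomAcyclic_moduleHomComplex_iff G F A).2 (hA (ModuleCat.of R (F ⊗[R] G)))

lemma isPureProjective_of_isHomAcyclic {X : ModuleCat.{u} R}
    (hX : ∀ A, IsPureAcyclic A → IsHomAcyclic X A) : IsPureProjective X := by
  refine fun A hA => (isPureAcyclic_iff_isHomAcyclic _).2 fun F _ => ?_
  rw [isHomAcyclic_moduleHomComplex_iff]
  exact ((isHomAcyclic_moduleHomComplex_iff X F A).1 (hX _ (hA.moduleHomComplex F))).of_iso
    (BraidedCategory.braiding F X)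

variable {P A : CochainComplex (ModuleCat.{u} R) ℤ} {F : ModuleCat.{u} R}

variable (A) in
/-- Evaluation at an element of `F`, as a morphism from the complex `Hom_R(F, A)` to `A`. -/
def evalHom (f : F) : moduleHomComplex F A ⟶ A where
  f j := ModuleCat.ofHom (LinearMap.applyₗ f ∘ₗ
    (ModuleCat.homLinearEquiv (S := R) (M := F) (N := A.X j)).toLinearMap)
  comm' _ _ _ := rfl

/-- Currying: a cochain with values in `Hom_R(F, A)` is a cochain with values in `A` depending
linearly on an element of `F`. -/
def cochainModuleHomEquiv (n : ℤ) :
    Cochain P (moduleHomComplex F A) n ≃ (F →ₗ[R] Cochain P A n) where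
  toFun w :=
    { toFun f := w.comp (Cochain.ofHom (evalHom A f)) (add_zero n)
      map_add' f g := by
        ext p q hpq t
        simp only [Cochain.add_v, Cochain.comp_zero_cochain_v, Cochain.ofHom_v]
        exact map_add (ModuleCat.Hom.hom (w.v p q hpq t : F ⟶ A.X q)) f g
      map_smul' c f := by
        ext p q hpq t
        simp only [RingHom.id_apply, Cochain.smul_v, Cochain.comp_zero_cochain_v, Cochain.ofHom_v]
        exact map_smul (ModuleCat.Hom.hom (w.v p q hpq t : F ⟶ A.X q)) c f }
  invFun x := Cochain.mk fun p q hpq => ModuleCat.ofHom₂ <|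
    LinearMap.mk₂ R (fun t f => (x f).v p q hpq t) (by simp) (by simp) (by simp) (by simp)
  left_inv w := by
    ext p q hpq t
    refine ModuleCat.hom_ext (LinearMap.ext fun f => ?_)
    exact ConcreteCategory.congr_hom
      (Cochain.comp_zero_cochain_v w (Cochain.ofHom (evalHom A f)) p q hpq) t
  right_inv x := by
    ext f p q hpq t
    exact ConcreteCategory.congr_hom
      (Cochain.comp_zero_cochain_v _ (Cochain.ofHom (evalHom A f)) p q hpq) t

lemma cochainModuleHomEquiv_δ {n m : ℤ} (w : Cochain P (moduleHomComplex F A) n) (f : F) :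
    cochainModuleHomEquiv m (δ n m w) f = δ n m (cochainModuleHomEquiv n w f) :=
  (δ_comp_ofHom w (evalHom A f) m).symm

lemma isKPureProjective_of_isCochainAcyclic {P : CochainComplex (ModuleCat.{u} R) ℤ}
    (hP : ∀ A, IsPureAcyclic A → IsCochainAcyclic P A) : IsKPureProjective P := by
  refine fun A hA => (isPureAcyclic_iff_isHomAcyclic _).2 fun F _ i j k hij hjk x hx => ?_
  let x' : F →ₗ[R] Cochain P A j := x.hom
  have hx' (f : F) : δ j k (x' f) = 0 := ConcreteCategory.congr_hom hx f
  obtain ⟨w, hw⟩ := hP _ (hA.moduleHomComplex F) i j k hij hjk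
    ((cochainModuleHomEquiv j).symm x') <| by
      refine (cochainModuleHomEquiv k).injective (LinearMap.ext fun f => ?_)
      rw [cochainModuleHomEquiv_δ, Equiv.apply_symm_apply, hx']
      exact (Cochain.zero_comp _ (add_zero k)).symm
  refine ⟨ModuleCat.ofHom (cochainModuleHomEquiv i w),
    ModuleCat.hom_ext (LinearMap.ext fun f => ?_)⟩
  calc
    δ i j (cochainModuleHomEquiv i w f) = cochainModuleHomEquiv j (δ i j w) f :=
      (cochainModuleHomEquiv_δ w f).symm
    _ = x' f := by rw [hw, Equiv.apply_symm_apply]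

end HomTensor

section Truncation

open ComplexShape in
lemma isIso_ιTruncLE_f {C : Type*} [Category* C] [HasZeroMorphisms C] [HasZeroObject C]
    (M : CochainComplex C ℤ) [∀ i, M.HasHomology i] {i n : ℤ} (h : i < n) :
    IsIso ((M.ιTruncLE n).f i) := by
  have hi : (embeddingUpIntLE n).f (n - i).natAbs = i := by
    change n - ((n - i).natAbs : ℤ) = i
    lia
  have hi' : ¬ (embeddingUpIntLE n).BoundaryLE (n - i).natAbs := by
    rw [boundaryLE_embeddingUpIntLE_iff, Int.natAbs_eq_zero]
    lia
  -- `truncLE` is defined as `truncGE` in the opposite category.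
  have : IsIso ((HomologicalComplex.πTruncGE (HomologicalComplex.op M)
      (embeddingUpIntLE n).op).f i) :=
    (Embedding.isIso_liftExtend_f_iff (embeddingUpIntLE n).op _ _ hi).2
      (HomologicalComplex.isIso_restrictionToTruncGE' _ _ _ (by simpa using hi'))
  exact inferInstanceAs (IsIso ((HomologicalComplex.πTruncGE (HomologicalComplex.op M)
    (embeddingUpIntLE n).op).f i).unop)

lemma isHomColimit_truncLECocone {R : Type u} [CommRing R] (F : ModuleCat.{u} R)
    (M : CochainComplex (ModuleCat.{u} R) ℤ) :
    IsHomColimit F (truncLESystem M) (truncLECocone M).ι.app where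
  map_comp_ι f := (truncLECocone M).w f
  exists_lift p x := by
    have := isIso_ιTruncLE_f M (i := p) (n := ((p + 1).toNat : ℤ)) (by lia)
    obtain ⟨y, hy⟩ : ∃ y, y ≫ (M.ιTruncLE ((p + 1).toNat : ℤ)).f p = x :=
      ⟨x ≫ inv ((M.ιTruncLE ((p + 1).toNat : ℤ)).f p), by simp⟩
    exact ⟨(p + 1).toNat, y, hy⟩
  exists_eq_zero p n x hx := by
    have := mono_ιTruncLE M n
    have hmono : Mono ((M.ιTruncLE (n : ℤ)).f p) := inferInstance
    have hx₀ : x = 0 := hmono.right_cancellation x 0 (hx.trans zero_comp.symm)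
    exact ⟨n, 𝟙 n, by rw [hx₀, zero_comp]⟩

end Truncation

section PureProjectiveResolution

variable {R : Type u} [CommRing R]

lemma IsRelSemiprojective.isKPureProjective {P : CochainComplex (ModuleCat.{u} R) ℤ}
    (hP : IsRelSemiprojective FinPresentation.module P) : IsKPureProjective P :=
  isKPureProjective_of_isCochainAcyclic fun _ hA =>
    hP.isCochainAcyclic ((isPureAcyclic_iff_isRelAcyclic _).1 hA)

lemma IsRelResolution.isPureProjectiveResolution {P M : CochainComplex (ModuleCat.{u} R) ℤ}
    {f : P ⟶ M} (hf : IsRelResolution FinPresentation.module f) :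
    IsPureProjectiveResolution f where
  pureProjective p := isPureProjective_of_isHomAcyclic fun _ hA =>
    hf.isRelSemiprojective.isHomAcyclic_X ((isPureAcyclic_iff_isRelAcyclic _).1 hA) p
  pureQuasiIso := (isPureAcyclic_iff_isRelAcyclic _).2 hf.isRelAcyclic_mappingCone
  kPureProjective := hf.isRelSemiprojective.isKPureProjective

lemma nonempty_splitting_cokernelSequence {K L : CochainComplex (ModuleCat.{u} R) ℤ} (f : K ⟶ L)
    (p : ℤ) [hf : IsSplitMono (f.f p)] :
    Nonempty ((cokernelSequence f).map
      (HomologicalComplex.eval (ModuleCat.{u} R) (ComplexShape.up ℤ) p)).Splitting := by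
  have hS : (cokernelSequence f).Exact := ShortComplex.exact_cokernel f
  have : Epi (cokernelSequence f).g := coequalizer.π_epi
  obtain ⟨⟨hr⟩⟩ := hf
  exact ⟨ShortComplex.Splitting.ofExactOfRetraction _ (hS.map (HomologicalComplex.eval _ _ p))
    hr.retraction hr.id
    (inferInstanceAs (Epi ((HomologicalComplex.eval _ _ p).map (cokernelSequence f).g)))⟩

lemma isSpecialDirectSystem_of_isSplitMono {P : ℕ ⥤ CochainComplex (ModuleCat.{u} R) ℤ}
    (hP : ∀ n, IsRelSemiprojective FinPresentation.module (P.obj n))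
    (hs : ∀ (n : ℕ) (p : ℤ), IsSplitMono ((P.map (homOfLE n.le_succ)).f p)) :
    IsSpecialDirectSystem IsKPureProjective P := by
  have hsplit (n : ℕ) (p : ℤ) :=
    nonempty_splitting_cokernelSequence (P.map (homOfLE n.le_succ)) p
  refine ⟨(hP 0).isKPureProjective, fun n => HomologicalComplex.mono_of_mono_f _ inferInstance,
    fun n => isKPureProjective_of_isCochainAcyclic fun A hA => ?_, hsplit⟩
  rw [isPureAcyclic_iff_isRelAcyclic] at hA
  exact IsCochainAcyclic.of_degreewise_splitting (cokernelSequence (P.map (homOfLE n.le_succ)))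
    (fun p => (hsplit n p).some) ((hP n).isCochainAcyclic hA) ((hP (n + 1)).isCochainAcyclic hA)

end PureProjectiveResolution

end PureResolution

end

open PureResolution

theorem mainTheorem2 (R : Type u) [CommRing R] (M : CochainComplex (ModuleCat.{u} R) ℤ) :
    ∃ (P : ℕ ⥤ CochainComplex (ModuleCat.{u} R) ℤ)
      (φ : P ⟶ PureResolution.truncLESystem M)
      (c : Cocone P) (hc : IsColimit c),
      PureResolution.IsSpecialDirectSystem PureResolution.IsKPureProjective P ∧
      (∀ n : ℕ, PureResolution.IsBoundedAbove (P.obj n) ∧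
        PureResolution.IsPureProjectiveResolution (φ.app n)) ∧
      PureResolution.IsPureProjectiveResolution
        (hc.desc ((Cocone.precompose φ).obj (PureResolution.truncLECocone M))) := by
  have hsmall (a : FinPresentation R) : IsSequentiallySmall a.module :=
    have := isFinitelyPresentable_of_finitePresentation a.module
    isSequentiallySmall_of_isFinitelyPresentable _
  obtain ⟨P, φ, hsplit, hφ, hbounded⟩ := exists_isRelResolution_sequence hsmall (truncLESystem M)
    (b := Nat.cast) Nat.mono_cast
    fun n p h => CochainComplex.isZero_of_isStrictlyLE (M.truncLE (n : ℤ)) n p h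
  let c := colimit.cocone P
  have hc : IsColimit c := colimit.isColimit P
  have hcolimit : IsRelResolution FinPresentation.module
      (hc.desc ((Cocone.precompose φ).obj (truncLECocone M))) :=
    IsRelResolution.of_isColimit hc (fun a => hsmall a P c hc)
      (fun a => isHomColimit_truncLECocone a.module M) hφ hsplit
  exact ⟨P, φ, c, hc,
    isSpecialDirectSystem_of_isSplitMono (fun n => (hφ n).isRelSemiprojective) hsplit,
    fun n => ⟨⟨n, hbounded n⟩, (hφ n).isPureProjectiveResolution⟩,
    hcolimit.isPureProjectiveResolution⟩
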